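/- All graphs are finite, simple and undirected. A graph is \emph{matching covered} if it is connected, has at least one edge, and every edge lies in a perfect matching. For $X\subseteq V(G)$ let $\partial(X)$ be the set of edges with exactly one end in $X$. The cut $\partial(X)$ is \emph{tight} if $|M\cap\partial(X)|=1$ for every perfect matching $M$ of $G$, and \emph{trivial} if $|X|=1$ or $|V(G)\setminus X|=1$. A \emph{brace} is a bipartite matching covered graph all of whose tight cuts are trivial. The \emph{matching porosity} of $\partial(X)$ is the maximum of $|M\cap\partial(X)|$ over all perfect matchings $M$ of $G$. A \emph{perfect matching decomposition} of $G$ is a pair $(T,\delta)$, where $T$ is a finite tree all of whose vertices have degree $1$ or $3$ and $\delta$ is a bijection from the leaves of $T$ to $V(G)$. For an edge $t_1t_2$ of $T$ and $i\in\{1,2\}$ let $X_i\subseteq V(G)$ be the image under $\delta$ of the leaves of $T$ in the component of $T-t_1t_2$ containing $t_i$; the \emph{width} of $(T,\delta)$ is the maximum, over all edges $t_1t_2$ of $T$, of the matching porosity of $\partial(X_1)=\partial(X_2)$. Let $M$ be a perfect matching of $G$. A set $S\subseteq V(G)$ is \emph{$M$-conformal} if the edges of $M$ with both ends in $S$ form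 a perfect matching of $G[S]$ and the edges of $M$ with both ends outside $S$ form a perfect matching of $G-S$. The \emph{$M$-perfect matching width} $M\text{-}\mathrm{pmw}(G)$ is the smallest width of a perfect matching decomposition $(T,\delta)$ of $G$ such that for every edge $t_1t_2$ of $T$ neither of whose ends is a leaf, both $X_1$ and $X_2$ are $M$-conformal. \textbf{Proposition.} Let $G$ be a brace. Then the following statements are equivalent: \begin{enumerate} \item $M\text{-}\mathrm{pmw}(G)=2$ for some perfect matching $M$ of $G$; \item $M\text{-}\mathrm{pmw}(G)=2$ for all perfect matchings $M$ of $G$; \item $G$ is isomorphic to $C_4$ or to $K_{3,3}$. \end{enumerate} -/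

import Mathlib

/-! Perfect matchings are Mathlib's `M : G.Subgraph` with `M.IsPerfectMatching`. -/

namespace PMWidth

universe u

variable {V : Type u}

/-- The cut `∂(X)`: the edges of `G` joining a vertex of `X` to a vertex outside `X`. -/
def cut (G : SimpleGraph V) (X : Set V) : Set (Sym2 V) :=
  {e | e ∈ G.edgeSet ∧ ∃ u ∈ X, ∃ v ∉ X, e = s(u, v)}

/-- The matching porosity of the cut `∂(X)`: the maximum of `|M ∩ ∂(X)|` over all perfect
matchings `M` of `G`. -/
noncomputable def porosity (G : SimpleGraph V) (X : Set V) : ℕ :=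
  sSup {k | ∃ M : G.Subgraph, M.IsPerfectMatching ∧ k = (M.edgeSet ∩ cut G X).ncard}

/-- A matching covered graph: connected, with at least one edge, and every edge lies in a
perfect matching. -/
structure IsMatchingCovered (G : SimpleGraph V) : Prop where
  connected : G.Connected
  edgeSet_nonempty : G.edgeSet.Nonempty
  exists_perfectMatching :
    ∀ e ∈ G.edgeSet, ∃ M : G.Subgraph, M.IsPerfectMatching ∧ e ∈ M.edgeSet

/-- The cut `∂(X)` is tight: it contains exactly one edge of every perfect matching. -/
def IsTightCut (G : SimpleGraph V) (X : Set V) : Prop :=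
  ∀ M : G.Subgraph, M.IsPerfectMatching → (M.edgeSet ∩ cut G X).ncard = 1

/-- The cut `∂(X)` is trivial: one of its shores consists of exactly one vertex. -/
def IsTrivialCut (X : Set V) : Prop :=
  X.ncard = 1 ∨ Xᶜ.ncard = 1

/-- A brace: a bipartite matching covered graph without non-trivial tight cuts. -/
structure IsBrace (G : SimpleGraph V) : Prop where
  isBipartite : G.IsBipartite
  isMatchingCovered : IsMatchingCovered G
  isTrivialCut_of_isTightCut : ∀ X : Set V, IsTightCut G X → IsTrivialCut X

/-- A leaf of a tree: a vertex with exactly one neighbour. -/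
def IsLeaf {W : Type*} (T : SimpleGraph W) (t : W) : Prop :=
  (T.neighborSet t).ncard = 1

/-- A perfect matching decomposition `(T, δ)` with leaves labelled by `V`: a finite cubic tree
`T` (every vertex is a leaf or has degree three) with a bijection `δ` from its leaves to `V`. -/
structure PMDecomposition (V : Type u) where
  node : Type
  finite_node : Finite node
  tree : SimpleGraph node
  isTree : tree.IsTree
  cubic : ∀ t, IsLeaf tree t ∨ (tree.neighborSet t).ncard = 3
  δ : {t : node // IsLeaf tree t} ≃ V

/-- For a tree edge `t₁t₂`, the image under `δ` of the leaves of `T` lying in the component of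
`T - t₁t₂` that contains `t₁`. -/
def PMDecomposition.shore (D : PMDecomposition V) (t₁ t₂ : D.node) : Set V :=
  D.δ '' {t | (D.tree.deleteEdges {s(t₁, t₂)}).Reachable t₁ t.1}

/-- The width of `(T, δ)`: the maximum matching porosity of the cuts given by the edges of `T`. -/
noncomputable def PMDecomposition.width (G : SimpleGraph V) (D : PMDecomposition V) : ℕ :=
  sSup {k | ∃ t₁ t₂ : D.node, D.tree.Adj t₁ t₂ ∧ k = porosity G (D.shore t₁ t₂)}

/-- A set `S` is `M`-conformal: `M` restricted to `S` is a perfect matching of `G[S]`, and `M`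
restricted to the complement of `S` is a perfect matching of `G - S`. -/
def IsMConformal {G : SimpleGraph V} (M : G.Subgraph) (S : Set V) : Prop :=
  (M.induce Sᶜ).IsMatching ∧ (M.induce S).IsMatching

/-- An `M`-decomposition: for every inner edge `t₁t₂` of `T` (neither end is a leaf), both shores
are `M`-conformal. -/
def PMDecomposition.IsMDecomposition {G : SimpleGraph V} (M : G.Subgraph)
    (D : PMDecomposition V) : Prop :=
  ∀ t₁ t₂ : D.node, D.tree.Adj t₁ t₂ → ¬ IsLeaf D.tree t₁ → ¬ IsLeaf D.tree t₂ →
    IsMConformal M (D.shore t₁ t₂) ∧ IsMConformal M (D.shore t₂ t₁)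

/-- The `M`-perfect matching width of `G`: the smallest width of an `M`-decomposition. -/
noncomputable def mpmw (G : SimpleGraph V) (M : G.Subgraph) : ℕ :=
  sInf {k | ∃ D : PMDecomposition V, D.IsMDecomposition M ∧ k = D.width G}

end PMWidth

/-! Write `A` for a colour class of the brace `G`. The non-trivial part is that large braces have
width at least 4. A cubic tree has an edge with at least a third of the leaves on each side
(`exists_balanced`). In an `M`-decomposition with at least 8 leaves this edge is inner, so its shore
`X` is `M`-conformal, hence contains equally many vertices of both colours, and at least two
vertices of `A` lie on each side.

In a brace, `|N(S)| ≥ |S| + 2` for nonempty `S ⊆ A` with `|S| ≤ |A| - 2`, since otherwise `S ∪ N(S)`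
would give a non-trivial tight cut. This surplus yields two disjoint edges leaving `X` from `X ∩ A`
and, by Hall's theorem, a perfect matching through both. Colour balance forces two more matching
edges out of `X \ A`, so the porosity is at least 4 (`four_le_porosity`).

Width 2 thus forces `|A| ≤ 3`, while `|V| ≤ 2` gives width at most 1. For `|A| = 2` or `3` the
surplus makes `G` complete bipartite. Conversely, in these two cases a tree whose cherries are the
edges of `M` has width at most 2, and the same balance argument gives the lower bound 2. -/

namespace PMWidth

universe u

variable {V : Type u}

/-! ### Perfect matchings as involutions; elementary bounds on porosity and width. -/

/-- `m` sends every vertex to its partner in the perfect matching `M`. -/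
def IsMate {G : SimpleGraph V} (M : G.Subgraph) (m : V → V) : Prop :=
  ∀ v w, M.Adj v w ↔ w = m v

theorem exists_isMate {G : SimpleGraph V} {M : G.Subgraph} (hM : M.IsPerfectMatching) :
    ∃ m, IsMate M m := by
  rw [SimpleGraph.Subgraph.isPerfectMatching_iff] at hM
  choose m hm hm' using hM
  exact ⟨m, fun v w => ⟨fun h => hm' v w h, fun h => h ▸ hm v⟩⟩

namespace IsMate

variable {G : SimpleGraph V} {M : G.Subgraph} {m : V → V}

theorem isPerfectMatching (h : IsMate M m) : M.IsPerfectMatching := by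
  rw [SimpleGraph.Subgraph.isPerfectMatching_iff]
  exact fun v => ⟨m v, (h _ _).2 rfl, fun w hw => (h _ _).1 hw⟩

theorem adj (h : IsMate M m) (v : V) : G.Adj v (m v) :=
  M.adj_sub ((h _ _).2 rfl)

theorem involutive (h : IsMate M m) : Function.Involutive m := fun v =>
  ((h _ _).1 (M.symm.symm _ _ ((h v _).2 rfl))).symm

theorem injective (h : IsMate M m) : Function.Injective m := h.involutive.injective

theorem mk_mem_edgeSet (h : IsMate M m) {v w : V} : s(v, w) ∈ M.edgeSet ↔ w = m v := by
  rw [SimpleGraph.Subgraph.mem_edgeSet, h]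

theorem mk_mem_edgeSet_inter_cut (h : IsMate M m) {X : Set V} {v : V} (hv : v ∈ X)
    (hm : m v ∉ X) : s(v, m v) ∈ M.edgeSet ∩ cut G X :=
  ⟨h.mk_mem_edgeSet.2 rfl, (SimpleGraph.mem_edgeSet G).2 (h.adj v), v, hv, _, hm, rfl⟩

theorem eq_of_mem_edgeSet_inter_cut (h : IsMate M m) {X : Set V} {e : Sym2 V}
    (he : e ∈ M.edgeSet ∩ cut G X) : ∃ v ∈ X, m v ∉ X ∧ e = s(v, m v) := by
  obtain ⟨h1, -, v, hv, w, hw, rfl⟩ := he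
  obtain rfl := h.mk_mem_edgeSet.1 h1
  exact ⟨v, hv, hw, rfl⟩

end IsMate

theorem cut_compl (G : SimpleGraph V) (X : Set V) : cut G Xᶜ = cut G X := by
  ext e
  constructor
  · rintro ⟨h, u, hu, v, hv, rfl⟩
    exact ⟨h, v, by simpa using hv, u, hu, Sym2.eq_swap⟩
  · rintro ⟨h, u, hu, v, hv, rfl⟩
    exact ⟨h, v, hv, u, by simpa using hu, Sym2.eq_swap⟩

theorem porosity_compl (G : SimpleGraph V) (X : Set V) : porosity G Xᶜ = porosity G X := by
  simp only [porosity, cut_compl]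

theorem ncard_edgeSet_inter_cut_le [Finite V] {G : SimpleGraph V} {M : G.Subgraph}
    (hM : M.IsPerfectMatching) (X : Set V) : (M.edgeSet ∩ cut G X).ncard ≤ X.ncard := by
  obtain ⟨m, hm⟩ := exists_isMate hM
  refine (Set.ncard_le_ncard (t := (fun v => s(v, m v)) '' X) ?_).trans (Set.ncard_image_le)
  intro e he
  obtain ⟨v, hv, -, rfl⟩ := hm.eq_of_mem_edgeSet_inter_cut he
  exact ⟨v, hv, rfl⟩

theorem porosity_le_ncard [Finite V] (G : SimpleGraph V) (X : Set V) :
    porosity G X ≤ X.ncard := by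
  refine csSup_le' ?_
  rintro _ ⟨M, hM, rfl⟩
  exact ncard_edgeSet_inter_cut_le hM X

theorem ncard_le_porosity [Finite V] {G : SimpleGraph V} {M : G.Subgraph}
    (hM : M.IsPerfectMatching) (X : Set V) : (M.edgeSet ∩ cut G X).ncard ≤ porosity G X := by
  -- An unbounded `sSup` in `ℕ` is `0`, so an upper bound has to be supplied.
  refine le_csSup ⟨X.ncard, ?_⟩ ⟨M, hM, rfl⟩
  rintro _ ⟨M, hM, rfl⟩
  exact ncard_edgeSet_inter_cut_le hM X

theorem PMDecomposition.porosity_le_width [Finite V] (G : SimpleGraph V) (D : PMDecomposition V)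
    {t₁ t₂ : D.node} (h : D.tree.Adj t₁ t₂) : porosity G (D.shore t₁ t₂) ≤ D.width G := by
  refine le_csSup ⟨Nat.card V, ?_⟩ ⟨t₁, t₂, h, rfl⟩
  rintro _ ⟨s₁, s₂, -, rfl⟩
  exact (porosity_le_ncard G _).trans (Set.ncard_le_card _)

theorem PMDecomposition.width_le {G : SimpleGraph V} {D : PMDecomposition V} {k : ℕ}
    (h : ∀ t₁ t₂, D.tree.Adj t₁ t₂ → porosity G (D.shore t₁ t₂) ≤ k) : D.width G ≤ k := by
  refine csSup_le' ?_
  rintro _ ⟨s₁, s₂, hs, rfl⟩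
  exact h _ _ hs

/-! ### Neighbourhood surplus and extension of edges to perfect matchings. -/

/-- `A` is a colour class of a bipartition of `G`. -/
def IsColorClass (G : SimpleGraph V) (A : Set V) : Prop :=
  ∀ ⦃u v⦄, G.Adj u v → (u ∈ A ↔ v ∉ A)

theorem exists_isColorClass {G : SimpleGraph V} (h : G.IsBipartite) :
    ∃ A, IsColorClass G A := by
  obtain ⟨c⟩ := h
  refine ⟨{v | c v = 0}, fun u v huv => ?_⟩
  have := c.valid huv
  simp only [Set.mem_ofPred_eq]
  revert this
  generalize c u = x
  generalize c v = y
  revert x y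
  decide

/-- The set of neighbours of the vertices of `S`. -/
def nbhd (G : SimpleGraph V) (S : Set V) : Set V := {b | ∃ a ∈ S, G.Adj a b}

section Bipartite

variable {G : SimpleGraph V} {A : Set V} {M : G.Subgraph} {m : V → V}

theorem IsMate.mem_iff (hA : IsColorClass G A) (h : IsMate M m) (v : V) : v ∈ A ↔ m v ∉ A :=
  hA (h.adj v)

theorem IsMate.ncard_compl (hA : IsColorClass G A) (h : IsMate M m) :
    Aᶜ.ncard = A.ncard := by
  have : m '' A = Aᶜ := by
    ext v
    constructor
    · rintro ⟨a, ha, rfl⟩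
      exact (h.mem_iff hA a).1 ha
    · intro hv
      refine ⟨m v, ?_, h.involutive v⟩
      rw [h.mem_iff hA, h.involutive v]
      exact hv
  rw [← this, Set.ncard_image_of_injective _ h.injective]

theorem IsMate.image_subset_nbhd (h : IsMate M m) (S : Set V) : m '' S ⊆ nbhd G S := by
  rintro _ ⟨a, ha, rfl⟩
  exact ⟨a, ha, h.adj a⟩

theorem IsColorClass.nbhd_subset (hA : IsColorClass G A) {S : Set V} (hS : S ⊆ A) :
    nbhd G S ⊆ Aᶜ := by
  rintro b ⟨a, ha, hab⟩
  exact (hA hab).1 (hS ha)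

theorem exists_adj_mem_notMem (hG : G.Connected) {X : Set V} (hX : X.Nonempty)
    (hX' : X ≠ Set.univ) : ∃ u ∈ X, ∃ v ∉ X, G.Adj u v := by
  obtain ⟨a, ha⟩ := hX
  obtain ⟨b, hb⟩ := (Set.ne_univ_iff_exists_notMem _).1 hX'
  obtain ⟨p⟩ := hG.preconnected a b
  obtain ⟨d, -, h1, h2⟩ := p.exists_boundary_dart X ha hb
  exact ⟨_, h1, _, h2, d.adj⟩

theorem IsMatchingCovered.exists_isMate (hG : IsMatchingCovered G) {u v : V} (h : G.Adj u v) :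
    ∃ (M : G.Subgraph) (m : V → V), IsMate M m ∧ m u = v := by
  obtain ⟨M, hM, he⟩ := hG.exists_perfectMatching s(u, v) h
  obtain ⟨m, hm⟩ := PMWidth.exists_isMate hM
  exact ⟨M, m, hm, (hm.mk_mem_edgeSet.1 he).symm⟩

theorem IsMatchingCovered.exists_perfectMatching' (hG : IsMatchingCovered G) :
    ∃ M : G.Subgraph, M.IsPerfectMatching := by
  obtain ⟨e, he⟩ := hG.edgeSet_nonempty
  obtain ⟨M, hM, -⟩ := hG.exists_perfectMatching e he
  exact ⟨M, hM⟩

/-- If the inequality failed, every perfect matching would map `S` onto `nbhd G S`. Then no edge of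
a perfect matching could leave `S ∪ nbhd G S`, although connectedness provides an edge that does. -/
theorem IsMatchingCovered.ncard_lt_ncard_nbhd [Finite V] (hG : IsMatchingCovered G)
    (hA : IsColorClass G A) {S : Set V} (hS : S ⊆ A) (hne : S.Nonempty) (hSA : S ≠ A) :
    S.ncard < (nbhd G S).ncard := by
  by_contra! hlt
  have key : ∀ {M : G.Subgraph} {m : V → V}, IsMate M m → m '' S = nbhd G S := by
    intro M m hm
    refine Set.eq_of_subset_of_ncard_le (hm.image_subset_nbhd S) ?_
    rwa [Set.ncard_image_of_injective _ hm.injective]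
  obtain ⟨a, haA, haS⟩ := Set.exists_of_ssubset (hS.ssubset_of_ne hSA)
  have hN := hA.nbhd_subset hS
  obtain ⟨u, hu, v, hv, huv⟩ := exists_adj_mem_notMem (X := S ∪ nbhd G S) hG.connected
    (hne.mono Set.subset_union_left)
    ((Set.ne_univ_iff_exists_notMem _).2 ⟨a, fun h => h.elim haS fun h => hN h haA⟩)
  rcases hu with hu | hu
  · exact hv (Or.inr ⟨u, hu, huv⟩)
  · obtain ⟨M, m, hm, rfl⟩ := hG.exists_isMate huv
    rw [← key hm] at hu
    obtain ⟨s, hs, rfl⟩ := hu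
    rw [hm.involutive] at hv
    exact hv (Or.inl hs)

/-- With surplus exactly one, each perfect matching leaves a single vertex of `nbhd G S` unmatched
to `S`, so the cut around `S ∪ nbhd G S` is tight. It is non-trivial: that shore has `2|S| + 1 ≥ 3`
vertices and its complement contains `A \ S`, which has at least two. -/
theorem IsBrace.ncard_add_two_le_ncard_nbhd [Finite V] (hG : IsBrace G)
    (hA : IsColorClass G A) {S : Set V} (hS : S ⊆ A) (hne : S.Nonempty)
    (hSA : S.ncard + 2 ≤ A.ncard) : S.ncard + 2 ≤ (nbhd G S).ncard := by
  have hlt := hG.isMatchingCovered.ncard_lt_ncard_nbhd hA hS hne (by rintro rfl; omega)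
  by_contra! hlt'
  have hN := hA.nbhd_subset hS
  have hdisj : Disjoint S (nbhd G S) :=
    Set.disjoint_left.2 fun x hx hx' => hN hx' (hS hx)
  have htight : IsTightCut G (S ∪ nbhd G S) := by
    intro M hM
    obtain ⟨m, hm⟩ := exists_isMate hM
    have hsub := hm.image_subset_nbhd S
    have h1 : (nbhd G S \ m '' S).ncard = 1 := by
      rw [Set.ncard_sdiff hsub, Set.ncard_image_of_injective _ hm.injective]
      omega
    obtain ⟨b, hb⟩ := Set.ncard_eq_one.1 h1
    have hbN : b ∈ nbhd G S \ m '' S := hb ▸ rfl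
    rw [Set.ncard_eq_one]
    refine ⟨s(b, m b), Set.eq_singleton_iff_unique_mem.2 ⟨?_, ?_⟩⟩
    · refine hm.mk_mem_edgeSet_inter_cut (Or.inr hbN.1) ?_
      rintro (h | h)
      · exact hbN.2 ⟨_, h, hm.involutive b⟩
      · exact hN hbN.1 ((hm.mem_iff hA b).2 (hN h))
    · intro e he
      obtain ⟨v, hv, hmv, rfl⟩ := hm.eq_of_mem_edgeSet_inter_cut he
      rcases hv with hv | hv
      · exact absurd (Or.inr (hsub ⟨v, hv, rfl⟩)) hmv
      · have : v ∈ ({b} : Set V) := by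
          rw [← hb]
          refine ⟨hv, ?_⟩
          rintro ⟨s, hs, rfl⟩
          rw [hm.involutive] at hmv
          exact hmv (Or.inl hs)
        rw [Set.mem_singleton_iff.1 this]
  have hpos := (Set.ncard_pos).2 hne
  rcases hG.isTrivialCut_of_isTightCut _ htight with h | h
  · rw [Set.ncard_union_eq hdisj] at h
    omega
  · have h2 : A \ S ⊆ (S ∪ nbhd G S)ᶜ := by
      rintro x ⟨hx, hxS⟩ (h | h)
      exacts [hxS h, hN h hx]
    have h3 := Set.ncard_le_ncard h2
    rw [Set.ncard_sdiff hS] at h3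
    omega

theorem exists_isMate_of_injOn [Finite V] (hA : IsColorClass G A) (hcard : Aᶜ.ncard = A.ncard)
    {g : V → V} (hg : Set.InjOn g A) (hadj : ∀ a ∈ A, G.Adj a (g a)) :
    ∃ (M : G.Subgraph) (m : V → V), IsMate M m ∧ ∀ a ∈ A, m a = g a := by
  classical
  have himg : g '' A = Aᶜ := by
    refine Set.eq_of_subset_of_ncard_le ?_ ?_
    · rintro _ ⟨a, ha, rfl⟩
      exact (hA (hadj a ha)).1 ha
    · rw [Set.InjOn.ncard_image hg, hcard]
  have hinv : ∀ b : V, ∃ a, b ∉ A → a ∈ A ∧ g a = b := by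
    intro b
    by_cases hb : b ∈ A
    · exact ⟨b, fun h => absurd hb h⟩
    · have : b ∈ g '' A := himg ▸ hb
      obtain ⟨a, ha, rfl⟩ := this
      exact ⟨a, fun _ => ⟨ha, rfl⟩⟩
  choose h hh using hinv
  set m : V → V := fun v => if v ∈ A then g v else h v with hm
  have hmA : ∀ v ∈ A, m v = g v := fun v hv => if_pos hv
  have hmB : ∀ v ∉ A, m v = h v := fun v hv => if_neg hv
  have hinvol : ∀ v, m (m v) = v := by
    intro v
    by_cases hv : v ∈ A
    · have hgv := (hA (hadj v hv)).1 hv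
      rw [hmA v hv, hmB _ hgv]
      exact hg (hh _ hgv).1 hv (hh _ hgv).2
    · rw [hmB v hv, hmA _ (hh v hv).1, (hh v hv).2]
  have hadj' : ∀ v, G.Adj v (m v) := by
    intro v
    by_cases hv : v ∈ A
    · rw [hmA v hv]; exact hadj v hv
    · rw [hmB v hv]
      have := hadj _ (hh v hv).1
      rw [(hh v hv).2] at this
      exact this.symm
  refine ⟨⟨Set.univ, fun v w => w = m v, ?_, fun _ => trivial, ⟨?_⟩⟩, m, fun v w => Iff.rfl, hmA⟩
  · rintro v _ rfl
    exact hadj' v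
  · rintro v _ rfl
    exact (hinvol v).symm

/-- Two disjoint edges of a brace lie in a common perfect matching. -/
theorem IsBrace.exists_isMate_of_disjoint [Finite V] (hG : IsBrace G) (hA : IsColorClass G A)
    {a₁ a₂ b₁ b₂ : V} (h₁ : G.Adj a₁ b₁) (h₂ : G.Adj a₂ b₂) (ha₁ : a₁ ∈ A) (ha₂ : a₂ ∈ A)
    (ha : a₁ ≠ a₂) (hb : b₁ ≠ b₂) :
    ∃ (M : G.Subgraph) (m : V → V), IsMate M m ∧ m a₁ = b₁ ∧ m a₂ = b₂ := by
  classical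
  have := Fintype.ofFinite V
  obtain ⟨M₀, hM₀⟩ := hG.isMatchingCovered.exists_perfectMatching'
  obtain ⟨m₀, hm₀⟩ := exists_isMate hM₀
  let ι := {a : V // a ∈ A ∧ a ≠ a₁ ∧ a ≠ a₂}
  let t : ι → Finset V := fun a => {b | G.Adj a b ∧ b ≠ b₁ ∧ b ≠ b₂}
  -- Hall's condition for `A \ {a₁, a₂}` with `b₁`, `b₂` forbidden: the surplus of two pays for the
  -- two forbidden vertices.
  obtain ⟨f, hf, hft⟩ := (Finset.all_card_le_biUnion_card_iff_exists_injective t).1 (by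
    intro s
    rcases s.eq_empty_or_nonempty with rfl | hs
    · simp
    set S : Set V := Subtype.val '' (s : Set ι) with hSdef
    have hScard : S.ncard = s.card := by
      rw [hSdef, Set.ncard_image_of_injective _ Subtype.val_injective, Set.ncard_coe_finset]
    have hSA : S ⊆ A := by
      rintro _ ⟨a, -, rfl⟩
      exact a.2.1
    have h2 : S.ncard + 2 ≤ A.ncard := by
      have hd : Disjoint S {a₁, a₂} := by
        rw [Set.disjoint_left]
        rintro _ ⟨a, -, rfl⟩ (h | h)
        exacts [a.2.2.1 h, a.2.2.2 h]
      have := Set.ncard_union_eq hd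
      rw [Set.ncard_pair ha] at this
      rw [← this]
      refine Set.ncard_le_ncard (Set.union_subset hSA ?_)
      rintro _ (rfl | rfl) <;> assumption
    have h3 := hG.ncard_add_two_le_ncard_nbhd hA hSA (hs.to_set.image _) h2
    have h4 : nbhd G S \ {b₁, b₂} ⊆ (s.biUnion t : Finset V) := by
      rintro b ⟨⟨_, ⟨a, has, rfl⟩, hab⟩, hb'⟩
      simp only [Set.mem_insert_iff, Set.mem_singleton_iff, not_or] at hb'
      rw [Finset.mem_coe, Finset.mem_biUnion]
      exact ⟨a, has, by simp [t, hab, hb']⟩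
    have h5 := Set.ncard_le_ncard h4
    rw [Set.ncard_coe_finset] at h5
    have h6 := Set.le_ncard_sdiff {b₁, b₂} (nbhd G S)
    rw [Set.ncard_pair hb] at h6
    omega)
  have hft' : ∀ a, G.Adj a.1 (f a) ∧ f a ≠ b₁ ∧ f a ≠ b₂ := fun a => by
    simpa [t] using hft a
  let g : V → V := fun v => if h : v ∈ A ∧ v ≠ a₁ ∧ v ≠ a₂ then f ⟨v, h⟩ else
    if v = a₁ then b₁ else b₂
  have hg₁ : g a₁ = b₁ := by simp [g]
  have hg₂ : g a₂ = b₂ := by simp [g, ha.symm]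
  have hg : ∀ v (h : v ∈ A ∧ v ≠ a₁ ∧ v ≠ a₂), g v = f ⟨v, h⟩ := fun v h => dif_pos h
  have hcases : ∀ v ∈ A, v = a₁ ∨ v = a₂ ∨ (v ∈ A ∧ v ≠ a₁ ∧ v ≠ a₂) := by
    intro v hv; tauto
  have hinj : Set.InjOn g A := by
    intro v hv w hw hvw
    rcases hcases v hv with rfl | rfl | h <;> rcases hcases w hw with rfl | rfl | h'
    · rfl
    · exact absurd (hg₁.symm.trans (hvw.trans hg₂)) hb
    · exact absurd ((hg _ h').symm.trans (hvw.symm.trans hg₁)) (hft' _).2.1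
    · exact absurd (hg₁.symm.trans (hvw.symm.trans hg₂)) hb
    · rfl
    · exact absurd ((hg _ h').symm.trans (hvw.symm.trans hg₂)) (hft' _).2.2
    · exact absurd ((hg _ h).symm.trans (hvw.trans hg₁)) (hft' _).2.1
    · exact absurd ((hg _ h).symm.trans (hvw.trans hg₂)) (hft' _).2.2
    · rw [hg _ h, hg _ h'] at hvw
      exact congrArg Subtype.val (hf hvw)
  obtain ⟨M, m, hm, hmg⟩ := exists_isMate_of_injOn hA (hm₀.ncard_compl hA) hinj (by
    intro v hv
    rcases hcases v hv with rfl | rfl | h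
    · rwa [hg₁]
    · rwa [hg₂]
    · rw [hg _ h]; exact (hft' ⟨v, h⟩).1)
  exact ⟨M, m, hm, (hmg _ ha₁).trans hg₁, (hmg _ ha₂).trans hg₂⟩

/-! ### Lower bounds on the porosity of colour-balanced sets. -/

theorem ncard_inter_eq_ncard_diff [Finite V] (hA : IsColorClass G A) (h : IsMate M m)
    {X : Set V} (hX : ∀ v ∈ X, m v ∈ X) : (X ∩ A).ncard = (X \ A).ncard := by
  have : m '' (X ∩ A) = X \ A := by
    ext v
    constructor
    · rintro ⟨a, ⟨haX, haA⟩, rfl⟩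
      exact ⟨hX a haX, (h.mem_iff hA a).1 haA⟩
    · rintro ⟨hvX, hvA⟩
      refine ⟨m v, ⟨hX v hvX, ?_⟩, h.involutive v⟩
      rw [h.mem_iff hA, h.involutive v]
      exact hvA
  rw [← this, Set.ncard_image_of_injective _ h.injective]

/-- The vertices of `X \ A` matched inside `X` have their partners in `(X ∩ A) \ P`. As `X` is
balanced, at least `|P|` vertices of `X \ A` are therefore matched outside as well, which doubles
the number of cut edges. -/
theorem IsMate.two_mul_ncard_le_porosity [Finite V] (hA : IsColorClass G A) (h : IsMate M m)
    {X : Set V} (hX : (X ∩ A).ncard = (X \ A).ncard) {P : Set V} (hPX : P ⊆ X ∩ A)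
    (hP : ∀ v ∈ P, m v ∉ X) : 2 * P.ncard ≤ porosity G X := by
  set Q : Set V := {v ∈ X \ A | m v ∉ X} with hQ
  have hPQ : P.ncard ≤ Q.ncard := by
    have h1 : m '' ((X \ A) \ Q) ⊆ (X ∩ A) \ P := by
      rintro _ ⟨v, ⟨⟨hvX, hvA⟩, hvQ⟩, rfl⟩
      have hmX : m v ∈ X := by
        by_contra hc
        exact hvQ ⟨⟨hvX, hvA⟩, hc⟩
      refine ⟨⟨hmX, ?_⟩, fun hc => ?_⟩
      · rw [h.mem_iff hA, h.involutive v]; exact hvA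
      · have := hP _ hc
        rw [h.involutive] at this
        exact this hvX
    have h2 := Set.ncard_le_ncard h1
    have hQX : Q ⊆ X \ A := fun v hv => hv.1
    rw [Set.ncard_image_of_injective _ h.injective, Set.ncard_sdiff hPX, Set.ncard_sdiff hQX] at h2
    have h3 := Set.ncard_le_ncard hPX
    have h4 := Set.ncard_le_ncard hQX
    omega
  have hd : Disjoint P Q := Set.disjoint_left.2 fun v hv hv' => hv'.1.2 (hPX hv).2
  have hout : ∀ v ∈ P ∪ Q, v ∈ X ∧ m v ∉ X := by
    rintro v (hv | hv)
    exacts [⟨(hPX hv).1, hP v hv⟩, ⟨hv.1.1, hv.2⟩]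
  have hinj : Set.InjOn (fun v => s(v, m v)) (P ∪ Q) := by
    intro v hv w hw hvw
    rcases Sym2.eq_iff.1 hvw with h' | h'
    · exact h'.1
    · exact absurd (h'.1 ▸ (hout v hv).1) (hout w hw).2
  have hsub : (fun v => s(v, m v)) '' (P ∪ Q) ⊆ M.edgeSet ∩ cut G X := by
    rintro _ ⟨v, hv, rfl⟩
    exact h.mk_mem_edgeSet_inter_cut (hout v hv).1 (hout v hv).2
  have h5 := Set.ncard_le_ncard hsub
  rw [Set.InjOn.ncard_image hinj, Set.ncard_union_eq hd] at h5
  have := ncard_le_porosity h.isPerfectMatching X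
  omega

theorem IsMatchingCovered.two_le_porosity [Finite V] (hG : IsMatchingCovered G)
    (hA : IsColorClass G A) {X : Set V} (hX : (X ∩ A).ncard = (X \ A).ncard)
    (h1 : (X ∩ A).Nonempty) (h2 : (A \ X).Nonempty) : 2 ≤ porosity G X := by
  have hlt := hG.ncard_lt_ncard_nbhd hA Set.inter_subset_right h1 (by
    intro h
    obtain ⟨a, ha, ha'⟩ := h2
    rw [← h] at ha
    exact ha' ha.1)
  rw [hX] at hlt
  obtain ⟨b, ⟨a, ha, hab⟩, hb⟩ := Set.exists_mem_notMem_of_ncard_lt_ncard hlt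
  obtain ⟨M, m, hm, rfl⟩ := hG.exists_isMate hab
  have := hm.two_mul_ncard_le_porosity hA hX (P := {a}) (by simpa using ha) (by
    rintro _ rfl hc
    exact hb ⟨hc, (hA hab).1 ha.2⟩)
  simpa using this

theorem IsBrace.four_le_porosity [Finite V] (hG : IsBrace G)
    (hA : IsColorClass G A) {X : Set V} (hX : (X ∩ A).ncard = (X \ A).ncard)
    (h1 : 2 ≤ (X ∩ A).ncard) (h2 : 2 ≤ (A \ X).ncard) : 4 ≤ porosity G X := by
  have hsum : (X ∩ A).ncard + (A \ X).ncard = A.ncard := by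
    rw [Set.inter_comm]; exact Set.ncard_inter_add_ncard_sdiff_eq_ncard A X
  have hN := hG.ncard_add_two_le_ncard_nbhd hA (S := X ∩ A) Set.inter_subset_right
    ((Set.ncard_pos (Set.toFinite _)).1 (by omega)) (by omega)
  have hout : ∀ {a b}, a ∈ X ∩ A → G.Adj a b → b ∉ X \ A → b ∉ X := fun ha hab hb hc =>
    hb ⟨hc, (hA hab).1 ha.2⟩
  obtain ⟨b₁, ⟨a₁, ha₁, hab₁⟩, hb₁⟩ := Set.exists_mem_notMem_of_ncard_lt_ncard
    (s := X \ A) (t := nbhd G (X ∩ A)) (by omega)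
  -- Removing `a₁` still leaves a neighbourhood of size at least `|X \ A| + 1`, so a second edge
  -- leaves `X` from a different tail `a₂`.
  have hd := Set.ncard_sdiff_singleton_add_one ha₁
  have hN' := hG.ncard_add_two_le_ncard_nbhd hA (S := (X ∩ A) \ {a₁})
    (Set.sdiff_subset.trans Set.inter_subset_right) ((Set.ncard_pos (Set.toFinite _)).1 (by omega)) (by omega)
  obtain ⟨b₂, ⟨a₂, ha₂, hab₂⟩, hb₂⟩ := Set.exists_mem_notMem_of_ncard_lt_ncard
    (s := X \ A) (t := nbhd G ((X ∩ A) \ {a₁})) (by omega)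
  have main : ∀ {a a' b b'}, a ∈ X ∩ A → a' ∈ X ∩ A → G.Adj a b → G.Adj a' b' → b ∉ X \ A →
      b' ∉ X \ A → a ≠ a' → b ≠ b' → 4 ≤ porosity G X := by
    intro a a' b b' ha ha' hab hab' hb hb' hne hne'
    obtain ⟨M, m, hm, rfl, rfl⟩ := hG.exists_isMate_of_disjoint hA hab hab' ha.2 ha'.2 hne hne'
    have := hm.two_mul_ncard_le_porosity hA hX (P := {a, a'})
      (by rintro _ (rfl | rfl) <;> assumption) (by
        rintro _ (rfl | rfl)
        exacts [hout ha hab hb, hout ha' hab' hb'])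
    rwa [Set.ncard_pair hne] at this
  -- If both edges share their head, the full surplus of two gives an edge with another head `b₃`;
  -- it is disjoint from whichever of the first two has a different tail.
  by_cases hb : b₁ = b₂
  · subst hb
    obtain ⟨b₃, ⟨a₃, ha₃, hab₃⟩, hb₃⟩ := Set.exists_mem_notMem_of_ncard_lt_ncard
      (s := insert b₁ (X \ A)) (t := nbhd G (X ∩ A))
      (by have := Set.ncard_insert_le b₁ (X \ A); omega)
    rw [Set.mem_insert_iff, not_or] at hb₃
    by_cases h : a₃ = a₁
    · exact main ha₃ ha₂.1 hab₃ hab₂ hb₃.2 hb₂ (fun hc => ha₂.2 (hc ▸ h)) hb₃.1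
    · exact main ha₃ ha₁ hab₃ hab₁ hb₃.2 hb₁ h hb₃.1
  · exact main ha₁ ha₂.1 hab₁ hab₂ hb₁ hb₂ (fun hc => ha₂.2 hc.symm) hb

end Bipartite

end PMWidth

/-! ### Branches of cubic trees and the balanced edge. -/

namespace PMWidth

universe u

section Tree

variable {W : Type*} {T : SimpleGraph W}

/-- The component containing `t₁` of the graph `T` with the edge `t₁t₂` deleted. -/
def branch (T : SimpleGraph W) (t₁ t₂ : W) : Set W :=
  {t | (T.deleteEdges {s(t₁, t₂)}).Reachable t₁ t}

theorem mem_branch_self (t₁ t₂ : W) : t₁ ∈ branch T t₁ t₂ :=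
  SimpleGraph.Reachable.refl _

theorem mem_branch_of_adj {t₁ t₂ x y : W} (hx : x ∈ branch T t₁ t₂) (h : T.Adj x y)
    (hne : s(x, y) ≠ s(t₁, t₂)) : y ∈ branch T t₁ t₂ :=
  SimpleGraph.Reachable.trans hx
    (SimpleGraph.Adj.reachable (SimpleGraph.deleteEdges_adj.2 ⟨h, by simpa using hne⟩))

theorem branch_induction {t₁ t₂ : W} {p : W → Prop} (h0 : p t₁)
    (hs : ∀ x y, x ∈ branch T t₁ t₂ → p x → T.Adj x y → s(x, y) ≠ s(t₁, t₂) → p y) {t : W}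
    (ht : t ∈ branch T t₁ t₂) : p t := by
  have ht' := (SimpleGraph.reachable_iff_reflTransGen _ _).1 ht
  induction ht' with
  | refl => exact h0
  | tail hx hxy ih =>
    rw [SimpleGraph.deleteEdges_adj] at hxy
    have hx' := (SimpleGraph.reachable_iff_reflTransGen _ _).2 hx
    exact hs _ _ hx' (ih hx') hxy.1 (by simpa using hxy.2)

theorem notMem_branch (hT : T.IsTree) {t₁ t₂ : W} (h : T.Adj t₁ t₂) : t₂ ∉ branch T t₁ t₂ :=
  SimpleGraph.isBridge_iff.1
    (SimpleGraph.isAcyclic_iff_forall_adj_isBridge.1 hT.isAcyclic h)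

theorem branch_compl (hT : T.IsTree) {t₁ t₂ : W} (h : T.Adj t₁ t₂) :
    (branch T t₁ t₂)ᶜ = branch T t₂ t₁ := by
  have hcov : ∀ t, t ∈ branch T t₁ t₂ ∨ t ∈ branch T t₂ t₁ := by
    intro t
    have := (SimpleGraph.reachable_iff_reflTransGen _ _).1 (hT.connected.preconnected t₁ t)
    induction this with
    | refl => exact Or.inl (mem_branch_self _ _)
    | @tail x y _ hxy ih =>
      by_cases hc : s(x, y) = s(t₁, t₂)
      · rcases Sym2.eq_iff.1 hc with ⟨rfl, rfl⟩ | ⟨rfl, rfl⟩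
        · exact Or.inr (mem_branch_self _ _)
        · exact Or.inl (mem_branch_self _ _)
      · rcases ih with ih | ih
        · exact Or.inl (mem_branch_of_adj ih hxy hc)
        · exact Or.inr (mem_branch_of_adj ih hxy (by rwa [Sym2.eq_swap (a := t₂)]))
  ext t
  refine ⟨fun ht => (hcov t).resolve_left ht, fun ht ht' => notMem_branch hT h ?_⟩
  have ht2 : (T.deleteEdges {s(t₁, t₂)}).Reachable t₂ t := by
    rw [Sym2.eq_swap]; exact ht
  exact SimpleGraph.Reachable.trans ht' ht2.symm

/-- This recursion over the neighbours of `t₁` drives the descent in `exists_balanced`. The converse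
direction uses acyclicity: a branch hanging off `t₁` never meets `t₁`, so it cannot use the deleted
edge. -/
theorem mem_branch_iff (hT : T.IsTree) {t₁ t₂ : W} (h : T.Adj t₁ t₂) {t : W} :
    t ∈ branch T t₁ t₂ ↔ t = t₁ ∨ ∃ u, T.Adj u t₁ ∧ u ≠ t₂ ∧ t ∈ branch T u t₁ := by
  constructor
  · refine fun ht => branch_induction
      (p := fun t => t = t₁ ∨ ∃ u, T.Adj u t₁ ∧ u ≠ t₂ ∧ t ∈ branch T u t₁) (Or.inl rfl) ?_ ht
    rintro x y - (rfl | ⟨u, hu, hut, hx⟩) hxy hne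
    · exact Or.inr ⟨y, hxy.symm, fun hc => hne (hc ▸ rfl), mem_branch_self _ _⟩
    · by_cases hc : s(x, y) = s(u, t₁)
      · rcases Sym2.eq_iff.1 hc with ⟨-, h⟩ | ⟨-, h⟩
        · exact Or.inl h
        · exact Or.inr ⟨u, hu, hut, h ▸ mem_branch_self _ _⟩
      · exact Or.inr ⟨u, hu, hut, mem_branch_of_adj hx hxy hc⟩
  · rintro (rfl | ⟨u, hu, hut, ht⟩)
    · exact mem_branch_self _ _
    · refine branch_induction (p := (· ∈ branch T t₁ t₂)) ?_ ?_ ht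
      · refine mem_branch_of_adj (mem_branch_self _ _) hu.symm fun hc => hut ?_
        rcases Sym2.eq_iff.1 hc with ⟨-, h⟩ | ⟨h', h⟩
        exacts [h, absurd h hu.ne]
      · intro x y hx hpx hxy hne
        refine mem_branch_of_adj hpx hxy fun hc => ?_
        have hx' : x ≠ t₁ := fun h => notMem_branch hT hu (h ▸ hx)
        have hy := mem_branch_of_adj hx hxy hne
        have hy' : y ≠ t₁ := fun h => notMem_branch hT hu (h ▸ hy)
        rcases Sym2.eq_iff.1 hc with ⟨h, -⟩ | ⟨-, h⟩
        exacts [hx' h, hy' h]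

theorem branch_ssubset (hT : T.IsTree) {t₁ t₂ u : W} (h : T.Adj t₁ t₂) (hu : T.Adj u t₁)
    (hut : u ≠ t₂) : branch T u t₁ ⊂ branch T t₁ t₂ := by
  rw [Set.ssubset_iff_of_subset fun t ht => (mem_branch_iff hT h).2 (Or.inr ⟨u, hu, hut, ht⟩)]
  exact ⟨t₁, mem_branch_self _ _, notMem_branch hT hu⟩

theorem branch_eq_singleton (hT : T.IsTree) {t₁ t₂ : W} (h : T.Adj t₁ t₂) (hl : IsLeaf T t₁) :
    branch T t₁ t₂ = {t₁} := by
  obtain ⟨w, hw⟩ := Set.ncard_eq_one.1 hl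
  have hn : ∀ u, T.Adj t₁ u → u = w := fun u hu => by
    have : u ∈ T.neighborSet t₁ := hu
    rwa [hw] at this
  ext t
  rw [mem_branch_iff hT h, Set.mem_singleton_iff]
  refine ⟨?_, Or.inl⟩
  rintro (h' | ⟨u, hu, hut, -⟩)
  · exact h'
  · exact absurd ((hn u hu.symm).trans (hn t₂ h).symm) hut

theorem branch_eq_union (hT : T.IsTree) {t₁ t₂ u w : W} (hn : T.neighborSet t₁ = {t₂, u, w})
    (hut : u ≠ t₂) (hwt : w ≠ t₂) :
    branch T t₁ t₂ = {t₁} ∪ (branch T u t₁ ∪ branch T w t₁) := by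
  have hadj : ∀ x, T.Adj t₁ x ↔ x = t₂ ∨ x = u ∨ x = w := fun x => by
    rw [← SimpleGraph.mem_neighborSet, hn]; simp
  have h2 : T.Adj t₁ t₂ := (hadj _).2 (by simp)
  have h3 : T.Adj u t₁ := ((hadj _).2 (by simp)).symm
  have h4 : T.Adj w t₁ := ((hadj _).2 (by simp)).symm
  ext t
  rw [mem_branch_iff hT h2]
  constructor
  · rintro (h | ⟨x, hx, hxt, ht⟩)
    · exact Or.inl h
    · rcases (hadj x).1 hx.symm with rfl | rfl | rfl
      exacts [absurd rfl hxt, Or.inr (Or.inl ht), Or.inr (Or.inr ht)]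
  · rintro (h | h | h)
    exacts [Or.inl h, Or.inr ⟨u, h3, hut, h⟩, Or.inr ⟨w, h4, hwt, h⟩]

end Tree

namespace PMDecomposition

variable {V : Type u} (D : PMDecomposition V)

theorem shore_eq (t₁ t₂ : D.node) :
    D.shore t₁ t₂ = D.δ '' {t | t.1 ∈ branch D.tree t₁ t₂} := rfl

theorem shore_compl {t₁ t₂ : D.node} (h : D.tree.Adj t₁ t₂) :
    (D.shore t₁ t₂)ᶜ = D.shore t₂ t₁ := by
  rw [shore_eq, shore_eq, ← Set.image_compl_eq D.δ.bijective]
  congr 1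
  ext t
  rw [Set.mem_ofPred_eq, ← branch_compl D.isTree h]
  rfl

theorem shore_of_isLeaf {t₁ t₂ : D.node} (h : D.tree.Adj t₁ t₂) (hl : IsLeaf D.tree t₁) :
    D.shore t₁ t₂ = {D.δ ⟨t₁, hl⟩} := by
  rw [shore_eq, branch_eq_singleton D.isTree h hl, ← Set.image_singleton]
  congr 1
  ext t
  simp [Subtype.ext_iff]

theorem shore_eq_union {t₁ t₂ u w : D.node} (hl : ¬ IsLeaf D.tree t₁)
    (hn : D.tree.neighborSet t₁ = {t₂, u, w}) (hut : u ≠ t₂) (hwt : w ≠ t₂) :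
    D.shore t₁ t₂ = D.shore u t₁ ∪ D.shore w t₁ := by
  rw [shore_eq, shore_eq, shore_eq, branch_eq_union D.isTree hn hut hwt, ← Set.image_union]
  congr 1
  ext t
  have : t.1 ≠ t₁ := fun h => hl (h ▸ t.2)
  simp [this]

theorem exists_adj : ∃ t₁ t₂, D.tree.Adj t₁ t₂ := by
  obtain ⟨t⟩ := D.isTree.connected.nonempty
  have : (D.tree.neighborSet t).Nonempty := by
    refine Set.nonempty_of_ncard_ne_zero ?_
    rcases D.cubic t with h | h
    · rw [show (D.tree.neighborSet t).ncard = 1 from h]; omega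
    · omega
  exact ⟨t, this.some, this.some_mem⟩

/-- Some edge of a cubic tree has at least a third of the leaves on each side. -/
theorem exists_balanced [Finite V] (hV : 2 ≤ Nat.card V) :
    ∃ t₁ t₂, D.tree.Adj t₁ t₂ ∧ Nat.card V ≤ 3 * (D.shore t₁ t₂).ncard ∧
      Nat.card V ≤ 3 * (D.shore t₂ t₁).ncard := by
  have := D.finite_node
  have hsum : ∀ {t₁ t₂}, D.tree.Adj t₁ t₂ →
      (D.shore t₁ t₂).ncard + (D.shore t₂ t₁).ncard = Nat.card V := fun h => by
    rw [← D.shore_compl h, Set.ncard_add_ncard_compl]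
  -- Descent on the size of the branch: if the far side has less than a third of the leaves, the
  -- near side has more than two thirds, so one of its two sub-branches has at least a third.
  have hstep : ∀ (n : ℕ) (t₁ t₂ : D.node), (branch D.tree t₁ t₂).ncard ≤ n →
      D.tree.Adj t₁ t₂ → Nat.card V ≤ 3 * (D.shore t₁ t₂).ncard →
      ∃ t₁ t₂, D.tree.Adj t₁ t₂ ∧ Nat.card V ≤ 3 * (D.shore t₁ t₂).ncard ∧
      Nat.card V ≤ 3 * (D.shore t₂ t₁).ncard := by
    intro n
    induction n with
    | zero =>
      intro t₁ t₂ h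
      have := (Set.ncard_pos (Set.toFinite _)).2
        ⟨t₁, mem_branch_self (T := D.tree) t₁ t₂⟩
      omega
    | succ n ih =>
      intro t₁ t₂ hn hadj hle
      by_cases hlt : Nat.card V ≤ 3 * (D.shore t₂ t₁).ncard
      · exact ⟨t₁, t₂, hadj, hle, hlt⟩
      have hs := hsum hadj
      by_cases hl : IsLeaf D.tree t₁
      · rw [D.shore_of_isLeaf hadj hl, Set.ncard_singleton] at hs hle
        omega
      have h3 := (D.cubic t₁).resolve_left hl
      have h2 := Set.ncard_sdiff_singleton_add_one (s := D.tree.neighborSet t₁) hadj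
      obtain ⟨u, w, huw, hset⟩ := Set.ncard_eq_two.1
        (show (D.tree.neighborSet t₁ \ {t₂}).ncard = 2 by omega)
      have hu : u ∈ D.tree.neighborSet t₁ \ {t₂} := by rw [hset]; simp
      have hw : w ∈ D.tree.neighborSet t₁ \ {t₂} := by rw [hset]; simp
      have hnb : D.tree.neighborSet t₁ = {t₂, u, w} := by
        rw [← hset, Set.insert_sdiff_singleton]
        exact (Set.insert_eq_of_mem (s := D.tree.neighborSet t₁) hadj).symm
      have hun := D.shore_eq_union hl hnb hu.2 hw.2
      have hcard := Set.ncard_union_le (D.shore u t₁) (D.shore w t₁)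
      rw [← hun] at hcard
      have hbr : ∀ x ∈ D.tree.neighborSet t₁ \ {t₂}, (branch D.tree x t₁).ncard ≤ n := by
        intro x hx
        have := Set.ncard_lt_ncard (branch_ssubset D.isTree hadj hx.1.symm hx.2)
        omega
      by_cases hc : Nat.card V ≤ 3 * (D.shore u t₁).ncard
      · exact ih u t₁ (hbr u hu) hu.1.symm hc
      · exact ih w t₁ (hbr w hw) hw.1.symm (by omega)
  obtain ⟨t₁, t₂, h⟩ := D.exists_adj
  have hs := hsum h
  by_cases hc : Nat.card V ≤ 3 * (D.shore t₁ t₂).ncard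
  · exact hstep _ t₁ t₂ le_rfl h hc
  · exact hstep _ t₂ t₁ le_rfl h.symm (by omega)

theorem not_isLeaf_of_two_le {t₁ t₂ : D.node} (h : D.tree.Adj t₁ t₂)
    (h2 : 2 ≤ (D.shore t₁ t₂).ncard) : ¬ IsLeaf D.tree t₁ := fun hl => by
  rw [D.shore_of_isLeaf h hl, Set.ncard_singleton] at h2
  omega

end PMDecomposition

end PMWidth

/-! ### Width bounds for `M`-decompositions. -/

namespace PMWidth

universe u

variable {V : Type u} {G : SimpleGraph V} {M : G.Subgraph} {m : V → V}

theorem IsMConformal.mem (h : IsMate M m) {X : Set V} (hX : IsMConformal M X) {v : V}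
    (hv : v ∈ X) : m v ∈ X := by
  obtain ⟨w, ⟨-, hw, hvw⟩, -⟩ := hX.2 (v := v) hv
  exact (h _ _).1 hvw ▸ hw

theorem IsMate.isMConformal (h : IsMate M m) {X : Set V} (hX : ∀ v ∈ X, m v ∈ X) :
    IsMConformal M X := by
  have key : ∀ {Y : Set V}, (∀ v ∈ Y, m v ∈ Y) → (M.induce Y).IsMatching := fun hY v hv =>
    ⟨m v, ⟨hv, hY v hv, (h _ _).2 rfl⟩, fun w hw => (h _ _).1 hw.2.2⟩
  refine ⟨key fun v hv hc => hv ?_, key hX⟩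
  have := hX _ hc
  rwa [h.involutive] at this

theorem IsMConformal.compl {X : Set V} (hX : IsMConformal M X) : IsMConformal M Xᶜ :=
  ⟨by rw [compl_compl]; exact hX.2, hX.1⟩

/-- Four vertices ensure that a third rounds up to two, so the balanced edge has no leaf end and its
shores are conformal. The factor 6 is a third of the vertices, half of them in `A`. -/
theorem PMDecomposition.exists_balanced_inner [Finite V] {A : Set V} (hA : IsColorClass G A)
    (h : IsMate M m) {D : PMDecomposition V} (hD : D.IsMDecomposition M)
    (hV : 4 ≤ Nat.card V) :
    ∃ X : Set V, porosity G X ≤ D.width G ∧ (X ∩ A).ncard = (X \ A).ncard ∧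
      Nat.card V ≤ 6 * (X ∩ A).ncard ∧ Nat.card V ≤ 6 * (A \ X).ncard := by
  obtain ⟨t₁, t₂, hadj, h1, h2⟩ := D.exists_balanced (by omega)
  obtain ⟨hX, -⟩ := hD t₁ t₂ hadj (D.not_isLeaf_of_two_le hadj (by omega))
    (D.not_isLeaf_of_two_le hadj.symm (by omega))
  have hwidth := D.porosity_le_width G hadj
  rw [← D.shore_compl hadj] at h2
  generalize D.shore t₁ t₂ = X at *
  have e1 := ncard_inter_eq_ncard_diff hA h (fun v hv => hX.mem h hv)
  have e2 := ncard_inter_eq_ncard_diff hA h (fun v hv => hX.compl.mem h hv)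
  have s1 := Set.ncard_inter_add_ncard_sdiff_eq_ncard X A
  have s2 := Set.ncard_inter_add_ncard_sdiff_eq_ncard Xᶜ A
  have e3 : A \ X = Xᶜ ∩ A := by rw [Set.inter_comm]; rfl
  refine ⟨X, hwidth, e1, by omega, ?_⟩
  rw [e3]
  omega

theorem PMDecomposition.two_le_width [Finite V] (hG : IsMatchingCovered G) {A : Set V}
    (hA : IsColorClass G A) (h : IsMate M m) {D : PMDecomposition V}
    (hD : D.IsMDecomposition M) (hV : 4 ≤ Nat.card V) : 2 ≤ D.width G := by
  obtain ⟨X, hX, he, h1, h2⟩ := D.exists_balanced_inner hA h hD hV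
  exact (hG.two_le_porosity hA he ((Set.ncard_pos (Set.toFinite _)).1 (by omega))
    ((Set.ncard_pos (Set.toFinite _)).1 (by omega))).trans hX

theorem PMDecomposition.four_le_width [Finite V] (hG : IsBrace G) {A : Set V}
    (hA : IsColorClass G A) (h : IsMate M m) {D : PMDecomposition V}
    (hD : D.IsMDecomposition M) (hV : 8 ≤ Nat.card V) : 4 ≤ D.width G := by
  obtain ⟨X, hX, he, h1, h2⟩ := D.exists_balanced_inner hA h hD (by omega)
  exact (hG.four_le_porosity hA he (by omega) (by omega)).trans hX

theorem PMDecomposition.width_le_one [Finite V] (D : PMDecomposition V)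
    (hV : Nat.card V ≤ 2) : D.width G ≤ 1 := by
  refine D.width_le fun t₁ t₂ _ => ?_
  have h1 := porosity_le_ncard G (D.shore t₁ t₂)
  have h2 := porosity_le_ncard G (D.shore t₁ t₂)ᶜ
  rw [porosity_compl] at h2
  have := Set.ncard_add_ncard_compl (D.shore t₁ t₂)
  omega

/-! ### Decompositions of width at most 2 whose cherries are matching edges. -/

section Construction

/-- The graph obtained from `K` by attaching two pendant vertices `(i, true)` and `(i, false)`
to the vertex `c i`, for every `i`. -/
def cherryGraph {n : ℕ} {C : Type} (K : SimpleGraph C) (c : Fin n → C) :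
    SimpleGraph ((Fin n × Bool) ⊕ C) where
  Adj
    | .inl _, .inl _ => False
    | .inl p, .inr x => x = c p.1
    | .inr x, .inl p => x = c p.1
    | .inr x, .inr y => K.Adj x y
  symm := ⟨by
    rintro (p | x) (q | y) h
    exacts [h, h, h, SimpleGraph.Adj.symm h]⟩
  loopless := ⟨by
    rintro (p | x) h
    exacts [h, K.loopless.irrefl x h]⟩

variable {n : ℕ} {C : Type} {K : SimpleGraph C} {c : Fin n → C}

instance [DecidableEq C] [DecidableRel K.Adj] : DecidableRel (cherryGraph K c).Adj
  | .inl _, .inl _ => inferInstanceAs (Decidable False)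
  | .inl p, .inr x => inferInstanceAs (Decidable (x = c p.1))
  | .inr x, .inl p => inferInstanceAs (Decidable (x = c p.1))
  | .inr x, .inr y => inferInstanceAs (Decidable (K.Adj x y))

theorem isLeaf_cherryGraph_inl (p : Fin n × Bool) : IsLeaf (cherryGraph K c) (.inl p) := by
  refine Set.ncard_eq_one.2 ⟨.inr (c p.1), ?_⟩
  ext (q | x)
  · simp [cherryGraph]
  · simp [cherryGraph]

theorem connected_cherryGraph (hK : K.Connected) : (cherryGraph K c).Connected := by
  let f : K →g cherryGraph K c := ⟨Sum.inr, fun h => h⟩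
  obtain ⟨r⟩ := hK.nonempty
  have hr : ∀ t, (cherryGraph K c).Reachable (.inr r) t := by
    rintro (p | x)
    · have h : (cherryGraph K c).Adj (.inr (c p.1)) (.inl p) := rfl
      exact ((hK.preconnected r (c p.1)).map f).trans h.reachable
    · exact (hK.preconnected r x).map f
  have : Nonempty ((Fin n × Bool) ⊕ C) := ⟨.inr r⟩
  exact ⟨fun s t => (hr s).symm.trans (hr t)⟩

/-- By `hcherry`, each inner edge cuts off a single cherry, so one of its shores is `{v, m v}`:
conformal, and of porosity at most 2. Leaf edges have a one-vertex shore. -/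
theorem exists_isMDecomposition_width_le_two [Finite V] (h : IsMate M m) [Finite C]
    (e : Fin n × Bool ≃ V) (he : ∀ i, m (e (i, true)) = e (i, false))
    (hT : (cherryGraph K c).IsTree)
    (hcubic : ∀ x, ((cherryGraph K c).neighborSet (.inr x)).ncard = 3)
    (hcherry : ∀ x y, K.Adj x y → ∃ i,
      (cherryGraph K c).neighborSet (.inr x) = {.inr y, .inl (i, true), .inl (i, false)} ∨
      (cherryGraph K c).neighborSet (.inr y) = {.inr x, .inl (i, true), .inl (i, false)}) :
    ∃ D : PMDecomposition V, D.IsMDecomposition M ∧ D.width G ≤ 2 := by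
  have hinr : ∀ x, ¬ IsLeaf (cherryGraph K c) (.inr x) := fun x hx => by
    have := hcubic x
    unfold IsLeaf at hx
    omega
  let ε : Fin n × Bool ≃ {t // IsLeaf (cherryGraph K c) t} :=
    Equiv.ofBijective (fun p => ⟨.inl p, isLeaf_cherryGraph_inl p⟩) (by
      constructor
      · intro p q hpq
        exact Sum.inl_injective (congrArg Subtype.val hpq)
      · rintro ⟨p | x, ht⟩
        · exact ⟨p, rfl⟩
        · exact absurd ht (hinr x))
  let D : PMDecomposition V :=
    { node := (Fin n × Bool) ⊕ C
      finite_node := inferInstance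
      tree := cherryGraph K c
      isTree := hT
      cubic := by
        rintro (p | x)
        exacts [Or.inl (isLeaf_cherryGraph_inl p), Or.inr (hcubic x)]
      δ := ε.symm.trans e }
  have hleaf : ∀ p x, (cherryGraph K c).Adj (.inl p) (.inr x) →
      D.shore (.inl p) (.inr x) = {e p} := by
    intro p x hpx
    rw [D.shore_of_isLeaf hpx (isLeaf_cherryGraph_inl p)]
    congr 1
    exact congrArg e (ε.symm_apply_apply p)
  have hshore : ∀ x y i,
      (cherryGraph K c).neighborSet (.inr x) = {.inr y, .inl (i, true), .inl (i, false)} →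
      D.shore (.inr x) (.inr y) = {e (i, true), m (e (i, true))} := by
    intro x y i hn
    have hadj : ∀ b, (cherryGraph K c).Adj (.inr x) (.inl (i, b)) := by
      intro b
      rw [← SimpleGraph.mem_neighborSet, hn]
      cases b <;> simp
    rw [D.shore_eq_union (hinr x) hn Sum.inl_ne_inr Sum.inl_ne_inr, hleaf _ _ (hadj _).symm,
      hleaf _ _ (hadj _).symm, he]
    rfl
  have hmate : ∀ v : V, ∀ w ∈ ({v, m v} : Set V), m w ∈ ({v, m v} : Set V) := by
    rintro v _ (rfl | rfl)
    · simp
    · simp [h.involutive v]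
  have hinner : ∀ x y, K.Adj x y → ∃ v : V, D.shore (.inr x) (.inr y) = {v, m v} ∨
      (D.shore (.inr x) (.inr y))ᶜ = {v, m v} := by
    intro x y hxy
    obtain ⟨i, hi | hi⟩ := hcherry x y hxy
    · exact ⟨_, Or.inl (hshore x y i hi)⟩
    · exact ⟨_, Or.inr ((D.shore_compl (t₁ := .inr x) (t₂ := .inr y) hxy).trans
        (hshore y x i hi))⟩
  refine ⟨D, ?_, D.width_le ?_⟩
  · rintro (p | x) (q | y) hxy h1 h2
    · exact absurd (isLeaf_cherryGraph_inl p) h1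
    · exact absurd (isLeaf_cherryGraph_inl p) h1
    · exact absurd (isLeaf_cherryGraph_inl q) h2
    · have : IsMConformal M (D.shore (.inr x) (.inr y)) := by
        obtain ⟨v, hv | hv⟩ := hinner x y hxy
        · rw [hv]
          exact h.isMConformal (hmate v)
        · rw [← compl_compl (D.shore (.inr x) (.inr y)), hv]
          exact (h.isMConformal (hmate v)).compl
      refine ⟨this, ?_⟩
      rw [← D.shore_compl (t₁ := .inr x) (t₂ := .inr y) hxy]
      exact this.compl
  · rintro (p | x) (q | y) hxy
    · exact hxy.elim
    · rw [hleaf p y hxy]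
      exact (porosity_le_ncard G _).trans (by simp)
    · rw [← D.shore_compl (t₁ := .inl q) (t₂ := .inr x) hxy, porosity_compl, hleaf q x hxy]
      exact (porosity_le_ncard G _).trans (by simp)
    · obtain ⟨v, hv | hv⟩ := hinner x y hxy
      · rw [hv]
        exact (porosity_le_ncard G _).trans (by simpa using Set.ncard_insert_le v {m v})
      · rw [← porosity_compl, hv]
        exact (porosity_le_ncard G _).trans (by simpa using Set.ncard_insert_le v {m v})

theorem exists_equiv_of_ncard [Finite V] {A : Set V} (hA : IsColorClass G A) (h : IsMate M m)
    (hn : A.ncard = n) : ∃ e : Fin n × Bool ≃ V, ∀ i, m (e (i, true)) = e (i, false) := by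
  let a : Fin n ≃ A := (Finite.equivFinOfCardEq hn).symm
  let f : Fin n × Bool → V := fun p => if p.2 then a p.1 else m (a p.1)
  have ha : ∀ i, m (a i) ∉ A := fun i => (h.mem_iff hA _).1 (a i).2
  have hf : Function.Bijective f := by
    constructor
    · rintro ⟨i, b⟩ ⟨j, b'⟩ hij
      cases b <;> cases b' <;> simp only [f, if_true, Bool.false_eq_true, if_false] at hij
      · rw [a.injective (Subtype.ext (h.injective hij))]
      · exact absurd (hij ▸ (a j).2) (ha i)
      · exact absurd (hij ▸ (a i).2) (ha j)
      · rw [a.injective (Subtype.ext hij)]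
    · intro v
      by_cases hv : v ∈ A
      · exact ⟨(a.symm ⟨v, hv⟩, true), by simp [f]⟩
      · have hv' : m v ∈ A := by rwa [h.mem_iff hA, h.involutive]
        exact ⟨(a.symm ⟨m v, hv'⟩, false), by simp [f, h.involutive v]⟩
  exact ⟨Equiv.ofBijective f hf, fun i => rfl⟩

theorem isTree_cherryGraph [Fintype C] [DecidableEq C] [DecidableRel K.Adj] (hK : K.Connected)
    (hcard : (cherryGraph K c).edgeFinset.card + 1 = Fintype.card ((Fin n × Bool) ⊕ C)) :
    (cherryGraph K c).IsTree := by
  rw [SimpleGraph.isTree_iff_connected_and_card]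
  refine ⟨connected_cherryGraph hK, ?_⟩
  rw [Nat.card_eq_fintype_card, Nat.card_eq_fintype_card, ← hcard,
    SimpleGraph.edgeFinset_card]

theorem exists_width_le_two_of_ncard_eq_two [Finite V] {A : Set V} (hA : IsColorClass G A)
    (h : IsMate M m) (hn : A.ncard = 2) :
    ∃ D : PMDecomposition V, D.IsMDecomposition M ∧ D.width G ≤ 2 := by
  obtain ⟨e, he⟩ := exists_equiv_of_ncard hA h hn
  -- Two cherries joined by an edge.
  refine exists_isMDecomposition_width_le_two (K := (⊤ : SimpleGraph (Fin 2))) (c := id) h e he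
    (isTree_cherryGraph SimpleGraph.connected_top (by decide)) ?_ ?_
  · intro x
    rw [Set.ncard_eq_toFinset_card']
    revert x
    decide
  · intro x y hxy
    refine ⟨x, Or.inl ?_⟩
    ext t
    simp only [SimpleGraph.mem_neighborSet, Set.mem_insert_iff, Set.mem_singleton_iff]
    revert x y t
    decide

theorem exists_width_le_two_of_ncard_eq_three [Finite V] {A : Set V} (hA : IsColorClass G A)
    (h : IsMate M m) (hn : A.ncard = 3) :
    ∃ D : PMDecomposition V, D.IsMDecomposition M ∧ D.width G ≤ 2 := by
  obtain ⟨e, he⟩ := exists_equiv_of_ncard hA h hn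
  -- Three cherries around a centre: `Fin.castSucc` attaches them to `0, 1, 2`, and the centre `3`
  -- carries no leaf.
  refine exists_isMDecomposition_width_le_two
    (K := SimpleGraph.starGraph (3 : Fin 4)) (c := Fin.castSucc) h e he
    (isTree_cherryGraph (SimpleGraph.isTree_starGraph _).connected (by decide)) ?_ ?_
  · intro x
    rw [Set.ncard_eq_toFinset_card']
    revert x
    decide
  · have key : ∀ (i : Fin 3) (t : (Fin 3 × Bool) ⊕ Fin 4),
        (cherryGraph (SimpleGraph.starGraph (3 : Fin 4)) Fin.castSucc).Adj
          (.inr i.castSucc) t ↔ t = .inr 3 ∨ t = .inl (i, true) ∨ t = .inl (i, false) := by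
      decide
    have hstar : ∀ x y : Fin 4, (SimpleGraph.starGraph (3 : Fin 4)).Adj x y →
        ∃ i : Fin 3, (x = i.castSucc ∧ y = 3) ∨ (y = i.castSucc ∧ x = 3) := by decide
    intro x y hxy
    obtain ⟨i, ⟨rfl, rfl⟩ | ⟨rfl, rfl⟩⟩ := hstar x y hxy
    exacts [⟨i, Or.inl (Set.ext (key i))⟩, ⟨i, Or.inr (Set.ext (key i))⟩]

end Construction

/-! ### Small braces are complete bipartite; the equivalence. -/

theorem nonempty_iso_completeBipartiteGraph [Finite V] {A : Set V} (hA : IsColorClass G A)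
    {n : ℕ} (h1 : A.ncard = n) (h2 : Aᶜ.ncard = n) (hadj : ∀ a ∈ A, ∀ b ∉ A, G.Adj a b) :
    Nonempty (G ≃g completeBipartiteGraph (Fin n) (Fin n)) := by
  classical
  let e : V ≃ Fin n ⊕ Fin n := (Equiv.Set.sumCompl A).symm.trans
    ((Finite.equivFinOfCardEq h1).sumCongr (Finite.equivFinOfCardEq h2))
  have hl : ∀ v ∈ A, ∃ i, e v = .inl i := fun v hv => by
    simp [e, Equiv.Set.sumCompl_symm_apply_of_mem hv]
  have hr : ∀ v ∉ A, ∃ i, e v = .inr i := fun v hv => by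
    simp [e, Equiv.Set.sumCompl_symm_apply_of_notMem hv]
  refine ⟨⟨e, ?_⟩⟩
  intro u v
  by_cases hu : u ∈ A <;> by_cases hv : v ∈ A
  · obtain ⟨i, hi⟩ := hl u hu
    obtain ⟨j, hj⟩ := hl v hv
    simpa [hi, hj] using fun h => (hA h).1 hu hv
  · obtain ⟨i, hi⟩ := hl u hu
    obtain ⟨j, hj⟩ := hr v hv
    simpa [hi, hj] using hadj u hu v hv
  · obtain ⟨i, hi⟩ := hr u hu
    obtain ⟨j, hj⟩ := hl v hv
    simpa [hi, hj] using (hadj v hv u hu).symm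
  · obtain ⟨i, hi⟩ := hr u hu
    obtain ⟨j, hj⟩ := hr v hv
    simpa [hi, hj] using fun h => hu ((hA h).2 hv)

theorem nonempty_completeBipartiteGraph_iso_cycleGraph :
    Nonempty (completeBipartiteGraph (Fin 2) (Fin 2) ≃g SimpleGraph.cycleGraph 4) :=
  ⟨⟨⟨Sum.elim ![0, 2] ![1, 3], ![.inl 0, .inr 0, .inl 1, .inr 1], by decide, by decide⟩, by
    simp only [SimpleGraph.cycleGraph_adj]
    rintro (a | a) (b | b) <;> fin_cases a <;> fin_cases b <;>
      simp <;> decide⟩⟩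

theorem IsBrace.adj_of_ncard_le_three [Finite V] (hG : IsBrace G) {A : Set V}
    (hA : IsColorClass G A) (h2 : 2 ≤ A.ncard) (h3 : A.ncard ≤ 3) (hc : Aᶜ.ncard = A.ncard)
    {a b : V} (ha : a ∈ A) (hb : b ∉ A) : G.Adj a b := by
  have hS : ({a} : Set V) ⊆ A := by simpa using ha
  -- For `|A| = 2` the strict surplus of a matching covered graph suffices; for `|A| = 3` the brace
  -- surplus of two is needed.
  have key : A.ncard ≤ (nbhd G {a}).ncard := by
    have h1 := hG.isMatchingCovered.ncard_lt_ncard_nbhd hA hS (Set.singleton_nonempty a) (by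
      intro h
      rw [← h, Set.ncard_singleton] at h2
      omega)
    have h4 := hG.ncard_add_two_le_ncard_nbhd hA hS (Set.singleton_nonempty a)
    rw [Set.ncard_singleton] at h1 h4
    omega
  have := Set.eq_of_subset_of_ncard_le (hA.nbhd_subset hS) (by rwa [hc])
  have hb' : b ∈ nbhd G {a} := this ▸ hb
  obtain ⟨_, rfl, h⟩ := hb'
  exact h

theorem mpmw_eq_two [Finite V] (hG : IsMatchingCovered G) {A : Set V}
    (hA : IsColorClass G A) (hn : A.ncard = 2 ∨ A.ncard = 3) (hM : M.IsPerfectMatching) :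
    mpmw G M = 2 := by
  obtain ⟨m, h⟩ := exists_isMate hM
  have hV := Set.ncard_add_ncard_compl A
  rw [h.ncard_compl hA] at hV
  obtain ⟨D, hD, hw⟩ : ∃ D : PMDecomposition V, D.IsMDecomposition M ∧ D.width G ≤ 2 :=
    hn.elim (exists_width_le_two_of_ncard_eq_two hA h)
      (exists_width_le_two_of_ncard_eq_three hA h)
  obtain ⟨D', hD', hw'⟩ := Nat.sInf_mem
    (s := {k | ∃ D : PMDecomposition V, D.IsMDecomposition M ∧ k = D.width G}) ⟨_, D, hD, rfl⟩
  have h1 : mpmw G M = D'.width G := hw'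
  have h2 : mpmw G M ≤ D.width G := Nat.sInf_le ⟨D, hD, rfl⟩
  have h3 := D'.two_le_width hG hA h hD' (by omega)
  omega

end PMWidth

theorem mainTheorem7 {V : Type*} [Finite V] (G : SimpleGraph V) (hG : PMWidth.IsBrace G) :
    List.TFAE [
      ∃ M : G.Subgraph, M.IsPerfectMatching ∧ PMWidth.mpmw G M = 2,
      ∀ M : G.Subgraph, M.IsPerfectMatching → PMWidth.mpmw G M = 2,
      Nonempty (G ≃g SimpleGraph.cycleGraph 4) ∨
        Nonempty (G ≃g completeBipartiteGraph (Fin 3) (Fin 3))] := by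
  obtain ⟨A, hA⟩ := PMWidth.exists_isColorClass hG.isBipartite
  obtain ⟨M₀, hM₀⟩ := hG.isMatchingCovered.exists_perfectMatching'
  obtain ⟨m₀, hm₀⟩ := PMWidth.exists_isMate hM₀
  have hc := hm₀.ncard_compl hA
  have hV := Set.ncard_add_ncard_compl A
  rw [hc] at hV
  tfae_have 1 → 3 := by
    rintro ⟨M, hM, hw⟩
    obtain ⟨m, h⟩ := PMWidth.exists_isMate hM
    -- The infimum of the empty set in `ℕ` is `0`, so the value 2 guarantees that an optimal
    -- decomposition exists.
    obtain ⟨D, hD, hD2⟩ := Nat.sInf_mem (Nat.nonempty_of_pos_sInf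
      (s := {k | ∃ D : PMWidth.PMDecomposition V, D.IsMDecomposition M ∧ k = D.width G})
      (by unfold PMWidth.mpmw at hw; omega))
    have hD3 : PMWidth.mpmw G M = D.width G := hD2
    have hge : 2 ≤ A.ncard := by
      by_contra hlt
      have := D.width_le_one (G := G) (by omega)
      omega
    have hle : A.ncard ≤ 3 := by
      by_contra hlt
      have := D.four_le_width hG hA h hD (by omega)
      omega
    have hadj : ∀ a ∈ A, ∀ b ∉ A, G.Adj a b := fun a ha b hb =>
      hG.adj_of_ncard_le_three hA hge hle hc ha hb
    obtain h2 | h3 : A.ncard = 2 ∨ A.ncard = 3 := by omega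
    · obtain ⟨f⟩ := PMWidth.nonempty_iso_completeBipartiteGraph hA h2 (hc.trans h2) hadj
      obtain ⟨g⟩ := PMWidth.nonempty_completeBipartiteGraph_iso_cycleGraph
      exact Or.inl ⟨f.trans g⟩
    · exact Or.inr (PMWidth.nonempty_iso_completeBipartiteGraph hA h3 (hc.trans h3) hadj)
  tfae_have 3 → 2 := by
    intro h M hM
    refine PMWidth.mpmw_eq_two hG.isMatchingCovered hA ?_ hM
    -- Only the number of vertices, 4 or 6, is taken from the isomorphism; it gives `|A| = 2` or
    -- `3`.
    rcases h with ⟨⟨f⟩⟩ | ⟨⟨f⟩⟩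
    · have := Nat.card_congr f.toEquiv
      simp at this
      omega
    · have := Nat.card_congr f.toEquiv
      simp at this
      omega
  tfae_have 2 → 1 := fun h => ⟨M₀, hM₀, h M₀ hM₀⟩
  tfae_finish
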